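/- **Setting.** Let $E$ and $A$ be Borel spaces (topological spaces homeomorphic to a Borel subset of a compact metric space) with Borel $\sigma$-algebras $\mathcal E,\mathcal A$, and let $T\in(0,\infty)$. Assume: * (H$\lambda$) $\lambda_0$ is a finite measure on $(A,\mathcal A)$ with full topological support, and $\lambda(x,a,dy)$ is a transition kernel from $E\times A$ to $E$ with $\sup_{x,a}\lambda(x,a,E)<\infty$; * (Hfg) $f:[0,T]\times E\times A\to\mathbb R$ and $g:E\to\mathbb R$ are bounded and Borel measurable. Let $\Omega$ be the set of $\omega=(e_0,a_0,(t_n,e_n,a_n)_{n\ge1})$ with $(e_0,a_0)\in E\times A$, $(t_n,e_n,a_n)\in((0,\infty)\times E\times A)\cup\{(\infty,\Delta,\Delta')\}$, $t_n\le t_{n+1}$, and $t_n<t_{n+1}$ whenever $t_n<\infty$. Put $T_0=0$, $T_n(\omega)=t_n$, $T_\infty=\lim_n T_n$, and let $(X_s,I_s)=(e_n,a_n)$ for $s\in[T_n,T_{n+1})$ and $(X_s,I_s)=(\Delta,\Delta')$ for $s\ge T_\infty$. Let $p(ds\,dy\,db)=\sum_{n\ge1}1_{\{T_n<\infty\}}\delta_{(T_n,e_n,a_n)}(ds\,dy\,db)$,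 let $\mathcal F_s$ be generated by $(e_0,a_0)$ and the variables $p((0,r]\times B)$, $0<r\le s$, $B\in\mathcal E\otimes\mathcal A$, let $\mathbb F=(\mathcal F_s)_{s\ge0}$, let $\mathcal F_\infty$ be generated by all the $\mathcal F_s$, and let $\mathcal P$ be the $\mathbb F$-predictable $\sigma$-algebra. For $(t,x,a)\in[0,T]\times E\times A$ let $\mathbb P^{t,x,a}$ be the (unique) probability measure on $(\Omega,\mathcal F_\infty)$ under which $(e_0,a_0)=(x,a)$ a.s. and $p$ has $\mathbb F$-compensator $$\tilde p(ds\,dy\,db)=1_{[t,T_\infty)}(s)\,\big(\lambda(X_{s-},I_{s-},dy)\,\delta_{I_{s-}}(db)+\lambda_0(db)\,\delta_{X_{s-}}(dy)\big)\,ds .$$ Let $q=p-\tilde p$, and write $\mathbb E$ for the expectation under $\mathbb P^{t,x,a}$. A *solution* is a triple $(Y,Z,K)$ such that * $Y=(Y_s)_{t\le s\le T}$ is real-valued, càdlàg and $\mathbb F$-adapted with $\mathbb E[\sup_{t\le s\le T}|Y_s|^2]<\infty$; * $Z:\Omega\times[t,T]\times E\times A\to\mathbb R$ is $\mathcal P\otimes\mathcal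 E\otimes\mathcal A$-measurable with $\mathbb E\int_t^T\int_{E\times A}|Z_s(y,b)|^2\,\tilde p(ds\,dy\,db)<\infty$; * $K=(K_s)_{t\le s\le T}$ is càdlàg, nondecreasing and predictable with $K_t=0$ and $\mathbb E[K_T^2]<\infty$; * $\mathbb P^{t,x,a}$-a.s., for all $s\in[t,T]$, $$Y_s=g(X_T)+\int_s^T f(r,X_r,I_r)\,dr+K_T-K_s-\int_{(s,T]}\int_{E\times A}Z_r(y,b)\,q(dr\,dy\,db)-\int_s^T\int_A Z_r(X_r,b)\,\lambda_0(db)\,dr;$$ * $Z_s(X_{s-},b)\le0$ for $ds\otimes d\mathbb P^{t,x,a}\otimes\lambda_0(db)$-almost every $(s,\omega,b)\in[t,T]\times\Omega\times A$. The path properties of $Y$ and $K$ are understood $\mathbb P^{t,x,a}$-a.s. A solution $(Y,Z,K)$ is *minimal* if for every solution $(\tilde Y,\tilde Z,\tilde K)$ we have, $\mathbb P^{t,x,a}$-a.s., $Y_s\le\tilde Y_s$ for all $s\in[t,T]$. **Proposition.** For every $(t,x,a)\in[0,T]\times E\times A$, if a minimal solution exists, then it is unique: if $(Y,Z,K)$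 and $(Y',Z',K')$ are minimal solutions, then $\mathbb P^{t,x,a}$-a.s. $Y_s=Y'_s$ and $K_s=K'_s$ for all $s\in[t,T]$, and $Z_s(y,b)=Z'_s(y,b)$ for $\tilde p(\omega,ds\,dy\,db)\,\mathbb P^{t,x,a}(d\omega)$-almost every $(\omega,s,y,b)\in\Omega\times[t,T]\times E\times A$. -/

import Mathlib

open MeasureTheory ProbabilityTheory Set Filter
open scoped NNReal ENNReal Topology

namespace JumpBSDE

universe u v

/-- A topological space homeomorphic to a Borel subset of a compact metric space
(a "Borel space", also called a Lusin space). -/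
def IsLusinSpace (E : Type u) [TopologicalSpace E] : Prop :=
  ∃ (K : Type u) (_ : MetricSpace K) (_ : CompactSpace K) (φ : E → K),
    Topology.IsEmbedding φ ∧ MeasurableSet[borel K] (range φ)

/-- Lebesgue measure on the time axis `[0, ∞)`. -/
noncomputable def leb : Measure ℝ≥0 :=
  ((volume : Measure ℝ).restrict (Ici 0)).map Real.toNNReal

instance sFinite_leb : SFinite leb := by
  unfold leb; infer_instance

section Canonical

variable {M : Type u}

/-- The time of a jump `(t, m)`; the fictitious jump `(∞, Δ)` is coded by `none`. -/
noncomputable def timeOf (o : Option (ℝ≥0 × M)) : ℝ≥0∞ := o.elim ⊤ fun z => (z.1 : ℝ≥0∞)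

/-- The canonical sample space: an initial point `m₀ ∈ M` and a sequence `(t_n, m_n)_{n ≥ 1}` in
`((0, ∞) × M) ∪ {(∞, Δ)}` with `t_n ≤ t_{n+1}`, and `t_n < t_{n+1}` if `t_n < ∞`.
The `(n+1)`-st jump is `jump n`. -/
structure Path (M : Type u) where
  init : M
  jump : ℕ → Option (ℝ≥0 × M)
  pos : ∀ n, 0 < timeOf (jump n)
  mono : ∀ n, timeOf (jump n) ≤ timeOf (jump (n + 1))
  strict : ∀ n, timeOf (jump n) < ⊤ → timeOf (jump n) < timeOf (jump (n + 1))

/-- The jump times `T_0 = 0 < T_1 ≤ T_2 ≤ …`. -/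
noncomputable def jumpTime (ω : Path M) : ℕ → ℝ≥0∞
  | 0 => 0
  | n + 1 => timeOf (ω.jump n)

/-- The marks: `m_0` is the initial point and `m_n` the mark of the `n`-th jump
(`none` is the cemetery point `Δ`). -/
def mark (ω : Path M) : ℕ → Option M
  | 0 => some ω.init
  | n + 1 => (ω.jump n).map Prod.snd

open Classical in
/-- The càdlàg state process: the mark `m_n` on `[T_n, T_{n+1})`, and `Δ` from `T_∞ = lim T_n` on. -/
noncomputable def state (s : ℝ≥0) (ω : Path M) : Option M :=
  if h : ∃ n, (s : ℝ≥0∞) < jumpTime ω (n + 1) then mark ω (Nat.find h) else none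

open Classical in
/-- The left limits of the state process: the initial point on `[0, T_1]`, the mark `m_n` on
`(T_n, T_{n+1}]`, and `Δ` from `T_∞` on. -/
noncomputable def leftState (s : ℝ≥0) (ω : Path M) : Option M :=
  if h : ∃ n, (s : ℝ≥0∞) ≤ jumpTime ω (n + 1) then mark ω (Nat.find h) else none

/-- A function of the left limit of the state is a measurable function of time. -/
theorem measurable_comp_leftState {X : Type*} [MeasurableSpace X] (h : Option M → X)
    (ω : Path M) : Measurable fun s => h (leftState s ω) := by
  classical
  intro S _
  have hm : ∀ n, MeasurableSet {s : ℝ≥0 | (s : ℝ≥0∞) ≤ jumpTime ω (n + 1)} := fun n =>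
    measurableSet_le measurable_coe_nnreal_ennreal measurable_const
  have key : (fun s => h (leftState s ω)) ⁻¹' S =
      (⋃ n, {s : ℝ≥0 | ((s : ℝ≥0∞) ≤ jumpTime ω (n + 1) ∧
          ∀ k < n, ¬ (s : ℝ≥0∞) ≤ jumpTime ω (k + 1)) ∧ h (mark ω n) ∈ S}) ∪
        {s : ℝ≥0 | (∀ n, ¬ (s : ℝ≥0∞) ≤ jumpTime ω (n + 1)) ∧ h none ∈ S} := by
    ext s
    simp only [mem_preimage, mem_union, mem_iUnion, mem_ofPred_eq, leftState]
    by_cases hs : ∃ n, (s : ℝ≥0∞) ≤ jumpTime ω (n + 1)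
    · rw [dif_pos hs]
      constructor
      · intro hS
        exact Or.inl ⟨Nat.find hs, ⟨Nat.find_spec hs, fun k hk => Nat.find_min hs hk⟩, hS⟩
      · rintro (⟨n, ⟨h1, h2⟩, h3⟩ | ⟨h1, _⟩)
        · rwa [(Nat.find_eq_iff hs).2 ⟨h1, h2⟩]
        · exact absurd hs (by simpa using h1)
    · rw [dif_neg hs]
      push Not at hs
      constructor
      · exact fun hS => Or.inr ⟨fun n => not_le.2 (hs n), hS⟩
      · rintro (⟨n, ⟨h1, _⟩, _⟩ | ⟨_, h2⟩)
        · exact absurd h1 (not_le.2 (hs n))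
        · exact h2
  rw [key]
  refine MeasurableSet.union (MeasurableSet.iUnion fun n => ?_) ?_
  · have h1 : MeasurableSet {s : ℝ≥0 | ∀ k < n, ¬ (s : ℝ≥0∞) ≤ jumpTime ω (k + 1)} := by
      simp only [ofPred_forall]
      exact MeasurableSet.iInter fun k => MeasurableSet.iInter fun _ => (hm k).compl
    exact ((hm n).inter h1).inter (MeasurableSet.const _)
  · have h1 : MeasurableSet {s : ℝ≥0 | ∀ n, ¬ (s : ℝ≥0∞) ≤ jumpTime ω (n + 1)} := by
      simp only [ofPred_forall]
      exact MeasurableSet.iInter fun k => (hm k).compl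
    exact h1.inter (MeasurableSet.const _)

variable [MeasurableSpace M]

/-- The random measure `p(ds dm) = ∑_{n ≥ 1} 1_{T_n < ∞} δ_{(T_n, m_n)}(ds dm)`. -/
noncomputable def jumpMeasure (ω : Path M) : Measure (ℝ≥0 × M) :=
  Measure.sum fun n => (ω.jump n).elim 0 Measure.dirac

/-- `𝓕_t`, generated by the initial point and the counting processes
`N(s, B) = p((0, s] × B)`, `0 < s ≤ t`, `B` measurable. -/
@[reducible]
noncomputable def natSigma (M : Type u) [MeasurableSpace M] (t : ℝ≥0) : MeasurableSpace (Path M) :=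
  MeasurableSpace.comap Path.init inferInstance ⊔
    ⨆ (s : ℝ≥0) (_ : s ∈ Ioc 0 t) (B : Set M) (_ : MeasurableSet B),
      MeasurableSpace.comap (fun ω => jumpMeasure ω (Ioc 0 s ×ˢ B)) inferInstance

theorem natSigma_mono : Monotone (natSigma M) := fun _ _ h =>
  sup_le_sup le_rfl (iSup_mono fun _ => iSup_mono' fun hr => ⟨⟨hr.1, hr.2.trans h⟩, le_rfl⟩)

/-- `𝓕_∞`, generated by all the `𝓕_t`. -/
noncomputable instance instMeasurableSpacePath : MeasurableSpace (Path M) := ⨆ t, natSigma M t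

/-- The natural filtration `𝔽 = (𝓕_t)_{t ≥ 0}` (neither completed nor enlarged). -/
noncomputable def natFiltration (M : Type u) [MeasurableSpace M] :
    Filtration ℝ≥0 (instMeasurableSpacePath : MeasurableSpace (Path M)) where
  seq := natSigma M
  mono' := natSigma_mono
  le' := le_iSup (natSigma M)

/-- The predictable σ-algebra `𝒫` on `[0, ∞) × Ω`. -/
noncomputable abbrev pred (M : Type u) [MeasurableSpace M] : MeasurableSpace (ℝ≥0 × Path M) :=
  (natFiltration M).predictable

/-- The trace of `𝒫` on `[t, T] × Ω`. -/
noncomputable abbrev predOn (M : Type u) [MeasurableSpace M] (t T : ℝ≥0) :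
    MeasurableSpace (Icc t T × Path M) :=
  (pred M).comap fun z => ((z.1 : ℝ≥0), z.2)

/-- `π'` is an `𝔽`-compensator (dual predictable projection) of the random measure `π` under `P`:
it is predictable (integrals of nonnegative predictable integrands are predictable processes), and
nonnegative predictable integrands have the same expected integral against `π` and `π'`. -/
structure IsCompensator (P : Measure (Path M)) (π π' : Path M → Measure (ℝ≥0 × M)) : Prop where
  predictable : ∀ H : (ℝ≥0 × Path M) × M → ℝ≥0∞,
    Measurable[(pred M).prod inferInstance] H →
      Measurable[pred M] fun z : ℝ≥0 × Path M =>
        ∫⁻ w in Ioc 0 z.1 ×ˢ univ, H ((w.1, z.2), w.2) ∂(π' z.2)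
  lintegral_eq : ∀ H : (ℝ≥0 × Path M) × M → ℝ≥0∞,
    Measurable[(pred M).prod inferInstance] H →
      ∫⁻ ω, ∫⁻ w, H ((w.1, ω), w.2) ∂(π ω) ∂P = ∫⁻ ω, ∫⁻ w, H ((w.1, ω), w.2) ∂(π' ω) ∂P

end Canonical

section Model

variable {E : Type u} {A : Type v} [MeasurableSpace E] [MeasurableSpace A]

/-- The rate transition measure
`Λ(x, a; dy db) = λ(x, a, dy) δ_a(db) + λ₀(db) δ_x(dy)` on `E × A`. -/
noncomputable def pairRate (lam : Kernel (E × A) E) (lam0 : Measure A) (z : E × A) :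
    Measure (E × A) :=
  (lam z).prod (Measure.dirac z.2) + (Measure.dirac z.1).prod lam0

/-- `s ↦ Λ(X_{s-}, I_{s-}; ·)` along a path, with the value `0` at the cemetery point. -/
noncomputable def leftRate (lam : Kernel (E × A) E) (lam0 : Measure A) (ω : Path (E × A)) :
    Kernel ℝ≥0 (E × A) where
  toFun s := (leftState s ω).elim 0 (pairRate lam lam0)
  measurable' := measurable_comp_leftState (fun o => o.elim 0 (pairRate lam lam0)) ω

instance isFiniteKernel_leftRate (lam : Kernel (E × A) E) [IsFiniteKernel lam] (lam0 : Measure A)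
    [IsFiniteMeasure lam0] (ω : Path (E × A)) : IsFiniteKernel (leftRate lam lam0 ω) := by
  obtain ⟨C, hC, h⟩ := IsFiniteKernel.exists_univ_le (κ := lam)
  refine ⟨C + lam0 univ, ENNReal.add_lt_top.2 ⟨hC, measure_lt_top _ _⟩, fun s => ?_⟩
  change ((leftState s ω).elim 0 (pairRate lam lam0)) univ ≤ _
  rcases leftState s ω with _ | z
  · simp
  · change (pairRate lam lam0 z) univ ≤ _
    rw [pairRate, Measure.add_apply, ← univ_prod_univ, Measure.prod_prod, Measure.prod_prod]
    simpa using add_le_add (h z) (le_refl (lam0 univ))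

/-- The random measure
`p̃(ds dy db) = 1_{[t, T_∞)}(s) Λ(X_{s-}, I_{s-}; dy db) ds` on `[0, ∞) × E × A`. -/
noncomputable def pTilde (lam : Kernel (E × A) E) (lam0 : Measure A) (t : ℝ≥0)
    (ω : Path (E × A)) : Measure (ℝ≥0 × E × A) :=
  (leb.restrict (Ici t)).compProd (leftRate lam lam0 ω)

/-- `P` is the law `ℙ^{t,x,a}`: the probability measure on `𝓕_∞` whose restriction to `𝓕_0` is the
point mass at `(x, a)` and for which `p` has `𝔽`-compensator `p̃`. -/
structure IsJumpLaw (lam : Kernel (E × A) E) (lam0 : Measure A) (t : ℝ≥0) (x : E) (a : A)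
    (P : Measure (Path (E × A))) : Prop where
  isProbabilityMeasure : IsProbabilityMeasure P
  map_init : P.map Path.init = Measure.dirac (x, a)
  isCompensator : IsCompensator P jumpMeasure (pTilde lam lam0 t)

/-- `y` is right-continuous with left limits on `[t, T]`. -/
def IsCadlagOn (y : ℝ≥0 → ℝ) (t T : ℝ≥0) : Prop :=
  (∀ s ∈ Ico t T, Tendsto y (𝓝[>] s) (𝓝 (y s))) ∧
    ∀ s ∈ Ioc t T, ∃ l, Tendsto y (𝓝[<] s) (𝓝 l)

/-- The space `𝐒²` of càdlàg adapted processes `(Y_s)_{t ≤ s ≤ T}` with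
`𝔼 sup_{t ≤ s ≤ T} |Y_s|² < ∞`. -/
structure MemS2 (P : Measure (Path (E × A))) (t T : ℝ≥0) (Y : ℝ≥0 → Path (E × A) → ℝ) : Prop where
  adapted : ∀ s ∈ Icc t T, Measurable[natFiltration (E × A) s] (Y s)
  cadlag : ∀ᵐ ω ∂P, IsCadlagOn (fun s => Y s ω) t T
  lintegral_lt_top : ∫⁻ ω, ⨆ s ∈ Icc t T, ‖Y s ω‖ₑ ^ 2 ∂P < ∞

/-- The space `𝐋²(q)` of `𝒫 ⊗ 𝓔 ⊗ 𝓐`-measurable maps `Z` on `Ω × [t, T] × E × A` with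
`𝔼 ∫_t^T ∫ |Z_s(y, b)|² p̃(ds dy db) < ∞`. -/
structure MemL2q (lam : Kernel (E × A) E) (lam0 : Measure A) (P : Measure (Path (E × A)))
    (t T : ℝ≥0) (Z : ℝ≥0 → Path (E × A) → E × A → ℝ) : Prop where
  measurable : Measurable[(predOn (E × A) t T).prod inferInstance]
    fun z : (Icc t T × Path (E × A)) × E × A => Z z.1.1 z.1.2 z.2
  lintegral_lt_top :
    ∫⁻ ω, ∫⁻ w in Icc t T ×ˢ univ, ‖Z w.1 ω w.2‖ₑ ^ 2 ∂(pTilde lam lam0 t ω) ∂P < ∞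

/-- The space `𝐊²` of nondecreasing predictable processes `(K_s)_{t ≤ s ≤ T}` in `𝐒²` with
`K_t = 0`. -/
structure MemK2 (P : Measure (Path (E × A))) (t T : ℝ≥0) (K : ℝ≥0 → Path (E × A) → ℝ) : Prop where
  memS2 : MemS2 P t T K
  predictable : Measurable[predOn (E × A) t T] fun z : Icc t T × Path (E × A) => K z.1 z.2
  monotone : ∀ᵐ ω ∂P, MonotoneOn (fun s => K s ω) (Icc t T)
  initial : ∀ᵐ ω ∂P, K t ω = 0

/-- The integral `∫_s^T ∫_{E × A} Z_r(y, b) q(dr dy db)`, over `(s, T]`, against the compensated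
measure `q = p - p̃`. -/
noncomputable def integralQ (lam : Kernel (E × A) E) (lam0 : Measure A) (t : ℝ≥0)
    (Z : ℝ≥0 → Path (E × A) → E × A → ℝ) (s T : ℝ≥0) (ω : Path (E × A)) : ℝ :=
  (∫ w in Ioc s T ×ˢ univ, Z w.1 ω w.2 ∂(jumpMeasure ω)) -
    ∫ w in Ioc s T ×ˢ univ, Z w.1 ω w.2 ∂(pTilde lam lam0 t ω)

/-- `(Y, Z, K)` solves the backward equation
`Y_s = g(X_T) + ∫_s^T f(r, X_r, I_r) dr + K_T - K_s - ∫_s^T ∫ Z_r(y, b) q(dr dy db)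
  - ∫_s^T ∫_A Z_r(X_r, b) λ₀(db) dr` for `s ∈ [t, T]`
with the constraint `Z_s(X_{s-}, b) ≤ 0`, `ds ⊗ dℙ ⊗ λ₀(db)`-a.e. on `[t, T] × Ω × A`.
All functions are given the value `0` at the cemetery point. -/
structure IsSolution (lam : Kernel (E × A) E) (lam0 : Measure A) (f : ℝ≥0 → E → A → ℝ) (g : E → ℝ)
    (P : Measure (Path (E × A))) (t T : ℝ≥0) (Y : ℝ≥0 → Path (E × A) → ℝ)
    (Z : ℝ≥0 → Path (E × A) → E × A → ℝ) (K : ℝ≥0 → Path (E × A) → ℝ) : Prop where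
  memS2 : MemS2 P t T Y
  memL2q : MemL2q lam lam0 P t T Z
  memK2 : MemK2 P t T K
  equation : ∀ᵐ ω ∂P, ∀ s ∈ Icc t T,
    Y s ω = (state T ω).elim 0 (fun z => g z.1)
      + (∫ r in Ioc s T, (state r ω).elim 0 (fun z => f r z.1 z.2) ∂leb)
      + K T ω - K s ω
      - integralQ lam lam0 t Z s T ω
      - ∫ r in Ioc s T, (∫ b, (state r ω).elim 0 (fun z => Z r ω (z.1, b)) ∂lam0) ∂leb
  constraint : ∀ᵐ w ∂((leb.restrict (Icc t T)).prod (P.prod lam0)),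
    (leftState w.1 w.2.1).elim 0 (fun z => Z w.1 w.2.1 (z.1, w.2.2)) ≤ 0

/-- A solution `(Y, Z, K)` is minimal if `Y ≤ Ỹ` on `[t, T]`, `ℙ`-a.s., for every solution
`(Ỹ, Z̃, K̃)`. -/
structure IsMinimalSolution (lam : Kernel (E × A) E) (lam0 : Measure A) (f : ℝ≥0 → E → A → ℝ)
    (g : E → ℝ) (P : Measure (Path (E × A))) (t T : ℝ≥0) (Y : ℝ≥0 → Path (E × A) → ℝ)
    (Z : ℝ≥0 → Path (E × A) → E × A → ℝ) (K : ℝ≥0 → Path (E × A) → ℝ) : Prop where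
  isSolution : IsSolution lam lam0 f g P t T Y Z K
  le : ∀ (Y' : ℝ≥0 → Path (E × A) → ℝ) (Z' : ℝ≥0 → Path (E × A) → E × A → ℝ)
    (K' : ℝ≥0 → Path (E × A) → ℝ), IsSolution lam lam0 f g P t T Y' Z' K' →
      ∀ᵐ ω ∂P, ∀ s ∈ Icc t T, Y s ω ≤ Y' s ω

end Model

end JumpBSDE

/-! Minimality applied in both directions gives `Y = Y'`; the rest is `IsSolution.unique_of_eq`,
that `Y` determines `Z` and `K`.

Subtracting the two equations, the terms in `Y`, `f`, `g` cancel, so `K - K'` equals a random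
constant minus the difference of the two `noise` terms. In a noise term only the integral against
`p` can charge a single time, so by `notMem_leftJumpSet_iff` the process `K - K'` can jump only at
the jump times of the path, and its jump there is governed by `Z - Z'` at the mark.

But `K - K'` is predictable, so its set of left discontinuities is predictable. This set has
countable sections and is therefore `p̃`-null, because `p̃` is dominated in time by a multiple of
Lebesgue measure. A predictable set is `p̃`-null if and only if it is `p`-null (the compensator
identity for its indicator), so almost surely `K - K'` does not jump at any jump time. Hence `Z =
Z'` holds `p`-a.e., and by the same principle `p̃`-a.e. The two noise terms then coincide, `K - K'`
is constant in time, and it vanishes at `t`.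

The technical work lies in the measurability of integrals against `p`, in the pathwise integrability
of the integrands, and in the passage between `X_r` and `X_{r-}`. -/

namespace JumpBSDE

universe u v

/-! ### Predictable σ-algebra: delays, extensions, sections. -/

section Predictable

variable {M : Type u} [MeasurableSpace M]

theorem pred_le_prod : pred M ≤ (Prod.instMeasurableSpace : MeasurableSpace (ℝ≥0 × Path M)) := by
  refine MeasurableSpace.generateFrom_le ?_
  rintro _ (⟨A, hA, rfl⟩ | ⟨i, A, hA, rfl⟩)
  · exact (measurableSet_singleton _).prod ((natFiltration M).le _ _ hA)
  · exact measurableSet_Ioi.prod ((natFiltration M).le _ _ hA)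

theorem measurable_pred_fst : Measurable[pred M] (Prod.fst : ℝ≥0 × Path M → ℝ≥0) := by
  refine @measurable_of_Ioi _ _ _ _ _ (pred M) _ _ _ _ fun i => ?_
  rw [← prod_univ]
  exact measurableSet_predictable_Ioi_prod MeasurableSet.univ

/-- A delay uses only older information: `(i, ∞) × A` pulls back to `(i + ε, ∞) × A`, and `A ∈ 𝓕_i ⊆
𝓕_{i+ε}`. Subtraction is truncated, so `{0} × A` pulls back to `[0, ε] × A`, still predictable since
`A ∈ 𝓕_0`. This makes left limits along `s - 1 / (n + 1)` accessible to predictable sets. -/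
theorem measurable_pred_shift (ε : ℝ≥0) :
    Measurable[pred M, pred M] fun z : ℝ≥0 × Path M => (z.1 - ε, z.2) := by
  refine @measurable_generateFrom _ _ (pred M) _ _ ?_
  rintro _ (⟨A, hA, rfl⟩ | ⟨i, A, hA, rfl⟩)
  · have : (fun z : ℝ≥0 × Path M => (z.1 - ε, z.2)) ⁻¹' ({⊥} ×ˢ A) =
        (({⊥} ×ˢ A) ∪ Ioi 0 ×ˢ A) ∩ Prod.fst ⁻¹' Iic ε := by
      ext ⟨s, ω⟩
      have := (zero_le (a := s)).eq_or_lt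
      simp only [bot_eq_zero, mem_preimage, mem_prod, mem_singleton_iff, tsub_eq_zero_iff_le,
        mem_inter_iff, mem_union, mem_Ioi, mem_Iic]
      grind
    rw [this]
    exact ((measurableSet_predictable_singleton_bot_prod hA).union
      (measurableSet_predictable_Ioi_prod hA)).inter (measurable_pred_fst measurableSet_Iic)
  · have : (fun z : ℝ≥0 × Path M => (z.1 - ε, z.2)) ⁻¹' (Ioi i ×ˢ A) = Ioi (i + ε) ×ˢ A := by
      ext ⟨s, ω⟩
      simp [lt_tsub_iff_right]
    rw [this]
    exact measurableSet_predictable_Ioi_prod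
      ((natFiltration M).mono (le_self_add : i ≤ i + ε) _ hA)

/-- A function that is measurable for the trace of `𝒫 ⊗ 𝓜` on `[t, T]` extends to a
`𝒫 ⊗ 𝓜`-measurable function. -/
theorem exists_pred_extension {t T : ℝ≥0} {U : ℝ≥0 → Path M → M → ℝ}
    (hU : Measurable[(predOn M t T).prod inferInstance]
      fun z : (Icc t T × Path M) × M => U z.1.1 z.1.2 z.2) :
    ∃ G : (ℝ≥0 × Path M) × M → ℝ, Measurable[(pred M).prod inferInstance] G ∧
      ∀ s ∈ Icc t T, ∀ ω y, U s ω y = G ((s, ω), y) := by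
  let j : Icc t T × Path M → ℝ≥0 × Path M := fun z => ((z.1 : ℝ≥0), z.2)
  -- The trace σ-algebra is a pullback, so a real function measurable for it factors through the
  -- inclusion.
  have h : (predOn M t T).prod inferInstance = ((pred M).prod inferInstance).comap
      (Prod.map j (id : M → M)) := by
    rw [MeasurableSpace.comap_prodMap, MeasurableSpace.comap_id]
  rw [h] at hU
  obtain ⟨G, hG, hUG⟩ := Measurable.exists_eq_measurable_comp
    (mY := (pred M).prod inferInstance) hU
  exact ⟨G, hG, fun s hs ω y => congrFun hUG ((⟨s, hs⟩, ω), y)⟩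

theorem exists_pred_extension' {t T : ℝ≥0} {U : ℝ≥0 → Path M → ℝ}
    (hU : Measurable[predOn M t T] fun z : Icc t T × Path M => U z.1 z.2) :
    ∃ G : ℝ≥0 × Path M → ℝ, Measurable[pred M] G ∧
      ∀ s ∈ Icc t T, ∀ ω, U s ω = G (s, ω) := by
  obtain ⟨G, hG, hUG⟩ := Measurable.exists_eq_measurable_comp (mY := pred M) hU
  exact ⟨G, hG, fun s hs ω => congrFun hUG (⟨s, hs⟩, ω)⟩

theorem measurable_section {β : Type*} [MeasurableSpace β] {H : (ℝ≥0 × Path M) × M → β}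
    (hH : Measurable[(pred M).prod inferInstance] H) (ω : Path M) :
    Measurable fun w : ℝ≥0 × M => H ((w.1, ω), w.2) := by
  have h1 : Measurable H := hH.mono
    (sup_le_sup (MeasurableSpace.comap_mono pred_le_prod) le_rfl) le_rfl
  exact h1.comp (by fun_prop)

theorem measurableSet_section {S : Set ((ℝ≥0 × Path M) × M)}
    (hS : MeasurableSet[(pred M).prod inferInstance] S) (ω : Path M) :
    MeasurableSet {w : ℝ≥0 × M | ((w.1, ω), w.2) ∈ S} := by
  have h1 : MeasurableSet S :=
    (sup_le_sup (MeasurableSpace.comap_mono pred_le_prod) le_rfl :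
      (pred M).prod inferInstance ≤ Prod.instMeasurableSpace) _ hS
  have h2 : Measurable fun w : ℝ≥0 × M => ((w.1, ω), w.2) := by fun_prop
  exact h2 h1

end Predictable

/-! ### Jump times and atoms of `p`. -/

section Jumps

variable {M : Type u}

/-- The set of the finite jump times of a path. -/
def jumpTimes (ω : Path M) : Set ℝ≥0 := {s | ∃ n y, ω.jump n = some (s, y)}

theorem countable_jumpTimes (ω : Path M) : (jumpTimes ω).Countable := by
  have : jumpTimes ω ⊆ ⋃ n, {s | ∃ y, ω.jump n = some (s, y)} := fun s ⟨n, y, h⟩ =>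
    mem_iUnion.2 ⟨n, y, h⟩
  refine (countable_iUnion fun n => Set.Subsingleton.countable ?_).mono this
  rintro s ⟨y, hy⟩ s' ⟨y', hy'⟩
  rw [hy] at hy'
  simpa using congrArg (fun o => o.elim 0 Prod.fst) hy'

theorem timeOf_lt_timeOf (ω : Path M) {m n : ℕ} (hmn : m < n) (h : timeOf (ω.jump n) < ⊤) :
    timeOf (ω.jump m) < timeOf (ω.jump n) := by
  have hmono := monotone_nat_of_le_succ ω.mono
  exact (ω.strict m ((hmono hmn.le).trans_lt h)).trans_le (hmono hmn)

theorem jump_index_unique (ω : Path M) {m n : ℕ} {s : ℝ≥0} {y y' : M}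
    (hm : ω.jump m = some (s, y)) (hn : ω.jump n = some (s, y')) : m = n := by
  have key : ∀ {m n : ℕ} {y y' : M}, ω.jump m = some (s, y) → ω.jump n = some (s, y') →
      ¬ m < n := fun hm hn hmn => by
    have := timeOf_lt_timeOf ω hmn (by simp [hn, timeOf])
    simp [hm, hn, timeOf] at this
  exact le_antisymm (not_lt.1 (key hn hm)) (not_lt.1 (key hm hn))

/-- The two definitions differ only in `<` against `≤`, which disagree only when `s` is a finite
`T_{n+1}`. -/
theorem state_eq_leftState {ω : Path M} {s : ℝ≥0} (hs : s ∉ jumpTimes ω) :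
    state s ω = leftState s ω := by
  have h : ∀ n, (s : ℝ≥0∞) < jumpTime ω (n + 1) ↔ (s : ℝ≥0∞) ≤ jumpTime ω (n + 1) := fun n => by
    refine ⟨le_of_lt, fun hle => hle.lt_of_ne fun heq => ?_⟩
    rcases hj : ω.jump n with _ | ⟨r, y⟩
    · simp [jumpTime, hj, timeOf] at heq
    · refine hs ⟨n, y, ?_⟩
      simp only [jumpTime, hj, timeOf, Option.elim_some, ENNReal.coe_inj] at heq
      rw [hj, heq]
  have hP : (fun n => (s : ℝ≥0∞) < jumpTime ω (n + 1)) = fun n => (s : ℝ≥0∞) ≤ jumpTime ω (n + 1) :=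
    funext fun n => propext (h n)
  unfold state leftState
  congr! 3

variable [MeasurableSpace M]

theorem ae_jumpMeasure_iff {ω : Path M} {p : ℝ≥0 × M → Prop} (hp : MeasurableSet {w | p w}) :
    (∀ᵐ w ∂jumpMeasure ω, p w) ↔ ∀ n z, ω.jump n = some z → p z := by
  rw [jumpMeasure, Measure.ae_sum_iff' hp]
  refine forall_congr' fun n => ?_
  rcases ω.jump n with _ | z
  · simp
  · simp [ae_dirac_iff hp]

theorem jumpMeasure_singleton_prod_of_notMem {ω : Path M} {s : ℝ≥0} (hs : s ∉ jumpTimes ω) :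
    jumpMeasure ω ({s} ×ˢ univ) = 0 := by
  have hm : MeasurableSet {w : ℝ≥0 × M | w ∉ ({s} : Set ℝ≥0) ×ˢ (univ : Set M)} :=
    ((measurableSet_singleton s).prod MeasurableSet.univ).compl
  have : ∀ᵐ w ∂jumpMeasure ω, w ∉ ({s} : Set ℝ≥0) ×ˢ (univ : Set M) := by
    rw [ae_jumpMeasure_iff hm]
    rintro n ⟨r, y⟩ hn ⟨h, -⟩
    obtain rfl : r = s := h
    exact hs ⟨n, y, hn⟩
  simpa only [ae_iff, not_not, ofPred_mem_eq] using this

/-- Finite jump times increase strictly, so a single index contributes at time `s`. -/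
theorem jumpMeasure_restrict_singleton_prod {ω : Path M} {n : ℕ} {s : ℝ≥0} {y : M}
    (hn : ω.jump n = some (s, y)) :
    (jumpMeasure ω).restrict ({s} ×ˢ univ) = Measure.dirac (s, y) := by
  have hm : MeasurableSet (({s} : Set ℝ≥0) ×ˢ (univ : Set M)) :=
    (measurableSet_singleton s).prod MeasurableSet.univ
  ext S hS
  rw [Measure.restrict_apply hS, jumpMeasure, Measure.sum_apply _ (hS.inter hm),
    tsum_eq_single n]
  · rw [hn, Option.elim_some, Measure.dirac_apply' _ hS, Measure.dirac_apply' _ (hS.inter hm)]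
    by_cases h : (s, y) ∈ S <;> simp [indicator, h]
  · intro k hk
    rcases hj : ω.jump k with _ | ⟨r, y'⟩
    · simp
    · rw [Option.elim_some, Measure.dirac_apply' _ (hS.inter hm), indicator_of_notMem]
      rintro ⟨-, h, -⟩
      obtain rfl : r = s := h
      exact hk (jump_index_unique ω hj hn)

end Jumps

/-! ### Lebesgue measure on the half-line. -/

section Leb

theorem leb_apply {S : Set ℝ≥0} (hS : MeasurableSet S) :
    leb S = volume (Real.toNNReal ⁻¹' S ∩ Ici 0) := by
  rw [leb, Measure.map_apply measurable_real_toNNReal hS,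
    Measure.restrict_apply (measurable_real_toNNReal hS)]

instance nullSingletonClass_leb : NullSingletonClass leb := ⟨fun s => by
  rw [leb_apply (measurableSet_singleton s)]
  -- The restriction to `[0, ∞)` matters at `s = 0`, where `Real.toNNReal` collapses the whole
  -- negative half-line.
  refine measure_mono_null (t := {(s : ℝ)}) ?_ (measure_singleton _)
  rintro r ⟨h, hr⟩
  rw [mem_singleton_iff, ← mem_singleton_iff.1 h, Real.coe_toNNReal _ hr]⟩

theorem leb_Iic_lt_top (T : ℝ≥0) : leb (Iic T) < ⊤ := by
  rw [leb_apply measurableSet_Iic]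
  refine (measure_mono (t := Icc 0 (T : ℝ)) ?_).trans_lt measure_Icc_lt_top
  rintro r ⟨h, hr⟩
  exact ⟨hr, Real.toNNReal_le_iff_le_coe.1 h⟩

end Leb

/-! ### Bounds on the jump rate and on `p̃`. -/

section Rate

variable {E : Type u} {A : Type v} [MeasurableSpace E] [MeasurableSpace A]

theorem exists_leftRate_le (lam : Kernel (E × A) E) [IsFiniteKernel lam] (lam0 : Measure A)
    [IsFiniteMeasure lam0] :
    ∃ C : ℝ≥0∞, C < ⊤ ∧ ∀ (ω : Path (E × A)) s, leftRate lam lam0 ω s univ ≤ C := by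
  obtain ⟨C, hC, h⟩ := IsFiniteKernel.exists_univ_le (κ := lam)
  refine ⟨C + lam0 univ, ENNReal.add_lt_top.2 ⟨hC, measure_lt_top _ _⟩, fun ω s => ?_⟩
  change ((leftState s ω).elim 0 (pairRate lam lam0)) univ ≤ _
  rcases leftState s ω with _ | z
  · simp
  · change (pairRate lam lam0 z) univ ≤ _
    rw [pairRate, Measure.add_apply, ← univ_prod_univ, Measure.prod_prod, Measure.prod_prod]
    simpa using add_le_add (h z) (le_refl (lam0 univ))

variable (lam : Kernel (E × A) E) (lam0 : Measure A) (t : ℝ≥0)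

/-- The rate transition measure `λ₀(db) δ_x(dy)` of the jumps of the second component. -/
noncomputable def actionRate (z : E × A) : Measure (E × A) := (Measure.dirac z.1).prod lam0

/-- The part `s ↦ λ₀(db) δ_{X_{s-}}(dy)` of the rate along a path. -/
noncomputable def leftRateAction (ω : Path (E × A)) : Kernel ℝ≥0 (E × A) where
  toFun s := (leftState s ω).elim 0 (actionRate lam0)
  measurable' := measurable_comp_leftState
    (fun o => o.elim 0 (actionRate lam0)) ω

theorem leftRateAction_le (ω : Path (E × A)) (s : ℝ≥0) :
    leftRateAction lam0 ω s ≤ leftRate lam lam0 ω s := by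
  change ((leftState s ω).elim 0 (actionRate lam0)) ≤
    (leftState s ω).elim 0 (pairRate lam lam0)
  rcases leftState s ω with _ | z
  · simp
  · exact le_add_of_nonneg_left (Measure.zero_le _)

variable [IsFiniteKernel lam] [IsFiniteMeasure lam0]

/-- The total rate is bounded uniformly in path and time. Consequently `p̃` charges no Lebesgue-null
set of times, and its mass on a bounded time interval is bounded independently of the path. -/
theorem exists_pTilde_prod_univ_le :
    ∃ C : ℝ≥0∞, C < ⊤ ∧ ∀ (ω : Path (E × A)) (S : Set ℝ≥0), MeasurableSet S →
      pTilde lam lam0 t ω (S ×ˢ univ) ≤ C * leb S := by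
  obtain ⟨C, hC, h⟩ := exists_leftRate_le lam lam0
  refine ⟨C, hC, fun ω S hS => ?_⟩
  rw [pTilde, Measure.compProd_apply_prod hS MeasurableSet.univ]
  calc ∫⁻ a in S, leftRate lam lam0 ω a univ ∂leb.restrict (Ici t)
      ≤ ∫⁻ _ in S, C ∂leb.restrict (Ici t) := lintegral_mono fun s => h ω s
    _ = C * leb.restrict (Ici t) S := by simp
    _ ≤ C * leb S := by gcongr; exact Measure.restrict_le_self

theorem pTilde_prod_univ_eq_zero (ω : Path (E × A)) {S : Set ℝ≥0} (hS : MeasurableSet S)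
    (h0 : leb S = 0) : pTilde lam lam0 t ω (S ×ˢ univ) = 0 := by
  obtain ⟨C, -, h⟩ := exists_pTilde_prod_univ_le lam lam0 t
  simpa [h0] using h ω S hS

instance isFiniteKernel_leftRateAction (ω : Path (E × A)) :
    IsFiniteKernel (leftRateAction lam0 ω) := by
  -- With `λ = 0` the full rate is just the action part.
  obtain ⟨C, hC, h⟩ := exists_leftRate_le (0 : Kernel (E × A) E) lam0
  exact ⟨C, hC, fun s => (leftRateAction_le 0 lam0 ω s univ).trans (h ω s)⟩

/-- The action part is one of the two summands of the rate. By this domination, integrability and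
a.e. equality under `p̃` carry over to the term `∫∫ Z_r(X_r, b) λ₀(db) dr`. -/
theorem compProd_leftRateAction_le (ω : Path (E × A)) :
    (leb.restrict (Ici t)).compProd (leftRateAction lam0 ω) ≤ pTilde lam lam0 t ω := by
  refine Measure.le_iff.2 fun S hS => ?_
  rw [pTilde, Measure.compProd_apply hS, Measure.compProd_apply hS]
  exact lintegral_mono fun s => leftRateAction_le lam lam0 ω s _

end Rate

/-! ### Measurability of integrals against `p`. -/

section Kernel

variable {M : Type u} [MeasurableSpace M]

theorem measurable_jumpMeasure_Ioc_prod (s : ℝ≥0) {B : Set M} (hB : MeasurableSet B) :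
    Measurable fun ω : Path M => jumpMeasure ω (Ioc 0 s ×ˢ B) := by
  rcases (zero_le (a := s)).eq_or_lt with rfl | hs
  · simp
  · have h : MeasurableSpace.comap (fun ω : Path M => jumpMeasure ω (Ioc 0 s ×ˢ B)) inferInstance
        ≤ natSigma M s := by
      refine le_sup_of_le_right ?_
      exact le_iSup₂_of_le s ⟨hs, le_rfl⟩ (le_iSup₂_of_le B hB le_rfl)
    exact measurable_iff_comap_le.2 (h.trans (le_iSup (natSigma M) s))

open Classical in
/-- The random measure `p` on `(0, T] × M`, replaced by `0` if it has more than `N` atoms there. -/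
noncomputable def truncJumpMeasure (T : ℝ≥0) (N : ℕ) (ω : Path M) : Measure (ℝ≥0 × M) :=
  if jumpMeasure ω (Ioc 0 T ×ˢ univ) ≤ N then (jumpMeasure ω).restrict (Ioc 0 T ×ˢ univ) else 0

theorem truncJumpMeasure_univ_le (T : ℝ≥0) (N : ℕ) (ω : Path M) :
    truncJumpMeasure T N ω univ ≤ N := by
  unfold truncJumpMeasure
  split_ifs with h
  · simpa using h
  · simp

instance isFiniteMeasure_truncJumpMeasure (T : ℝ≥0) (N : ℕ) (ω : Path M) :
    IsFiniteMeasure (truncJumpMeasure T N ω) :=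
  ⟨(truncJumpMeasure_univ_le T N ω).trans_lt (ENNReal.natCast_lt_top N)⟩

/-- The σ-algebra only provides the variables `p((0, s] × B)`. The truncated measure lives on `(0,
T]`, so these give its values on the rectangles `[0, s] × B`, a generating π-system. -/
theorem measurable_truncJumpMeasure (T : ℝ≥0) (N : ℕ) :
    Measurable (truncJumpMeasure T N : Path M → Measure (ℝ≥0 × M)) := by
  classical
  have hset : MeasurableSet {ω : Path M | jumpMeasure ω (Ioc 0 T ×ˢ univ) ≤ N} :=
    measurable_jumpMeasure_Ioc_prod T MeasurableSet.univ measurableSet_Iic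
  have key : ∀ (s : ℝ≥0) {B : Set M}, MeasurableSet B →
      Measurable fun ω : Path M => truncJumpMeasure T N ω (Iic s ×ˢ B) := fun s B hB => by
    have h : (fun ω : Path M => truncJumpMeasure T N ω (Iic s ×ˢ B)) = fun ω =>
        if jumpMeasure ω (Ioc 0 T ×ˢ univ) ≤ N then jumpMeasure ω (Ioc 0 (min s T) ×ˢ B) else 0 := by
      ext ω
      unfold truncJumpMeasure
      split_ifs
      · rw [Measure.restrict_apply (measurableSet_Iic.prod hB), prod_inter_prod, inter_univ,
          inter_comm, Ioc_inter_Iic, min_comm]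
      · simp
    rw [h]
    exact Measurable.ite hset (measurable_jumpMeasure_Ioc_prod _ hB) measurable_const
  have hspan : IsCountablySpanning (range (Iic : ℝ≥0 → Set ℝ≥0)) :=
    ⟨fun n => Iic n, fun n => ⟨_, rfl⟩, eq_univ_of_forall fun s =>
      mem_iUnion.2 (exists_nat_ge s)⟩
  refine Measurable.measure_of_isPiSystem
    (S := image2 (· ×ˢ ·) (range (Iic : ℝ≥0 → Set ℝ≥0)) {B : Set M | MeasurableSet B})
    (generateFrom_eq_prod ((borel_eq_generateFrom_Iic ℝ≥0).symm.trans
      (BorelSpace.measurable_eq (α := ℝ≥0)).symm) MeasurableSpace.generateFrom_measurableSet hspan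
      isCountablySpanning_measurableSet).symm
    (isPiSystem_Iic.prod MeasurableSpace.isPiSystem_measurableSet) ?_ ?_
  · rintro _ ⟨_, ⟨s, rfl⟩, B, hB, rfl⟩
    exact key s hB
  · have h : (fun ω : Path M => truncJumpMeasure T N ω univ) = fun ω =>
        truncJumpMeasure T N ω (Iic T ×ˢ univ) := by
      ext ω
      unfold truncJumpMeasure
      split_ifs
      · rw [Measure.restrict_apply_univ,
          Measure.restrict_apply (measurableSet_Iic.prod MeasurableSet.univ), prod_inter_prod,
          inter_univ, inter_comm, Ioc_inter_Iic, min_self]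
      · simp
    rw [h]
    exact key T MeasurableSet.univ

/-- Each truncation is a finite kernel, so its integrals are measurable. Where `p` has finite mass
on `(0, T]`, the truncation is exact for large `N`, and the supremum over `N` is the integral
against `p`. -/
theorem aemeasurable_lintegral_jumpMeasure {P : Measure (Path M)} {T : ℝ≥0}
    (hfin : ∀ᵐ ω ∂P, jumpMeasure ω (Ioc 0 T ×ˢ univ) < ⊤)
    {H : (ℝ≥0 × Path M) × M → ℝ≥0∞} (hH : Measurable H) :
    AEMeasurable (fun ω => ∫⁻ w in Ioc 0 T ×ˢ univ, H ((w.1, ω), w.2) ∂jumpMeasure ω) P := by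
  have hmeas : ∀ N : ℕ, Measurable fun ω : Path M =>
      ∫⁻ w, H ((w.1, ω), w.2) ∂truncJumpMeasure T N ω := fun N => by
    let κ : Kernel (Path M) (ℝ≥0 × M) := ⟨truncJumpMeasure T N, measurable_truncJumpMeasure T N⟩
    have : IsFiniteKernel κ := ⟨N, ENNReal.natCast_lt_top N, truncJumpMeasure_univ_le T N⟩
    exact Measurable.lintegral_kernel_prod_right' (κ := κ)
      (f := fun z : Path M × ℝ≥0 × M => H ((z.2.1, z.1), z.2.2)) (hH.comp (by fun_prop))
  refine ⟨fun ω => ⨆ N, ∫⁻ w, H ((w.1, ω), w.2) ∂truncJumpMeasure T N ω, .iSup hmeas, ?_⟩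
  filter_upwards [hfin] with ω hω
  obtain ⟨N, hN⟩ := ENNReal.exists_nat_gt hω.ne
  refine le_antisymm (le_iSup_of_le N ?_) (iSup_le fun k => ?_)
  · rw [truncJumpMeasure, if_pos hN.le]
  · unfold truncJumpMeasure
    split_ifs <;> simp

end Kernel

/-! ### The compensator identity on `(t, T]`. -/

section Compensator

variable {M : Type u} [MeasurableSpace M]

theorem measurable_indicator_Ioc {t T : ℝ≥0} {H : (ℝ≥0 × Path M) × M → ℝ≥0∞}
    (hH : Measurable[(pred M).prod inferInstance] H) :
    Measurable[(pred M).prod inferInstance]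
      (((fun z : (ℝ≥0 × Path M) × M => z.1.1) ⁻¹' Ioc t T).indicator H) := by
  let : MeasurableSpace (ℝ≥0 × Path M) := pred M
  have h1 : Measurable fun z : (ℝ≥0 × Path M) × M => z.1.1 :=
    measurable_pred_fst.comp measurable_fst
  exact hH.indicator (h1 measurableSet_Ioc)

theorem IsCompensator.setLIntegral_Ioc_eq {P : Measure (Path M)}
    {π π' : Path M → Measure (ℝ≥0 × M)} (h : IsCompensator P π π') (t T : ℝ≥0)
    {H : (ℝ≥0 × Path M) × M → ℝ≥0∞} (hH : Measurable[(pred M).prod inferInstance] H) :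
    ∫⁻ ω, ∫⁻ w in Ioc t T ×ˢ univ, H ((w.1, ω), w.2) ∂π ω ∂P =
      ∫⁻ ω, ∫⁻ w in Ioc t T ×ˢ univ, H ((w.1, ω), w.2) ∂π' ω ∂P := by
  have key : ∀ μ : Measure (ℝ≥0 × M), ∀ ω, ∫⁻ w in Ioc t T ×ˢ univ, H ((w.1, ω), w.2) ∂μ =
      ∫⁻ w, (((fun z : (ℝ≥0 × Path M) × M => z.1.1) ⁻¹' Ioc t T).indicator H) ((w.1, ω), w.2) ∂μ :=
    fun μ ω => by
      rw [← lintegral_indicator (measurableSet_Ioc.prod MeasurableSet.univ)]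
      congr! 2 with w
      simp [indicator]
  simp_rw [key]
  exact h.lintegral_eq _ (measurable_indicator_Ioc hH)

theorem IsCompensator.measurable_setLIntegral_Ioc {P : Measure (Path M)}
    {π π' : Path M → Measure (ℝ≥0 × M)} (h : IsCompensator P π π') (t T : ℝ≥0)
    {H : (ℝ≥0 × Path M) × M → ℝ≥0∞} (hH : Measurable[(pred M).prod inferInstance] H) :
    Measurable fun ω => ∫⁻ w in Ioc t T ×ˢ univ, H ((w.1, ω), w.2) ∂π' ω := by
  have h1 := (h.predictable _ (measurable_indicator_Ioc (t := t) (T := T) hH)).mono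
    pred_le_prod le_rfl
  have h2 := h1.comp (measurable_prodMk_left (x := T) (β := Path M))
  convert! h2 using 1
  ext ω
  simp only [Function.comp]
  rw [← lintegral_indicator (measurableSet_Ioc.prod MeasurableSet.univ),
    ← lintegral_indicator (measurableSet_Ioc.prod MeasurableSet.univ)]
  congr! 2 with w
  simp only [indicator, mem_prod, mem_Ioc, mem_univ, and_true, mem_preimage]
  have : t < w.1 → 0 < w.1 := fun h => (zero_le (a := t)).trans_lt h
  grind

theorem aemeasurable_setLIntegral_Ioc_jumpMeasure {P : Measure (Path M)} {T : ℝ≥0}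
    (hfin : ∀ᵐ ω ∂P, jumpMeasure ω (Ioc 0 T ×ˢ univ) < ⊤) (t : ℝ≥0)
    {H : (ℝ≥0 × Path M) × M → ℝ≥0∞} (hH : Measurable[(pred M).prod inferInstance] H) :
    AEMeasurable (fun ω => ∫⁻ w in Ioc t T ×ˢ univ, H ((w.1, ω), w.2) ∂jumpMeasure ω) P := by
  have h1 := aemeasurable_lintegral_jumpMeasure hfin
    ((measurable_indicator_Ioc (t := t) (T := T) hH).mono
      (sup_le_sup (MeasurableSpace.comap_mono pred_le_prod) le_rfl) le_rfl)
  convert! h1 using 1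
  ext ω
  rw [← lintegral_indicator (measurableSet_Ioc.prod MeasurableSet.univ),
    ← lintegral_indicator (measurableSet_Ioc.prod MeasurableSet.univ)]
  congr! 2 with w
  simp only [indicator, mem_prod, mem_Ioc, mem_univ, and_true, mem_preimage]
  have : t < w.1 → 0 < w.1 := fun h => (zero_le (a := t)).trans_lt h
  grind

end Compensator

theorem ae_restrict_jumpMeasure_iff {M : Type u} [MeasurableSpace M] {t T : ℝ≥0}
    {S : Set ((ℝ≥0 × Path M) × M)} (hS : MeasurableSet[(pred M).prod inferInstance] S)
    {ω : Path M} :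
    (∀ᵐ w ∂(jumpMeasure ω).restrict (Ioc t T ×ˢ univ), ((w.1, ω), w.2) ∉ S) ↔
      ∀ n z, ω.jump n = some z → z.1 ∈ Ioc t T → ((z.1, ω), z.2) ∉ S := by
  have hI : MeasurableSet (Ioc t T ×ˢ univ : Set (ℝ≥0 × M)) :=
    measurableSet_Ioc.prod MeasurableSet.univ
  have hm : MeasurableSet {w : ℝ≥0 × M | w ∈ Ioc t T ×ˢ (univ : Set M) →
      ((w.1, ω), w.2) ∉ S} := by
    convert! (hI.inter (measurableSet_section hS ω)).compl using 1
    ext w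
    simp
  rw [ae_restrict_iff' hI, ae_jumpMeasure_iff hm]
  simp

/-! ### Null sets and integrability under the jump law. -/

section Law

variable {E : Type u} {A : Type v} [MeasurableSpace E] [MeasurableSpace A]
  {lam : Kernel (E × A) E} {lam0 : Measure A} {t : ℝ≥0} {x : E} {a : A} {P : Measure (Path (E × A))}

/-- A predictable property that holds `p`-a.e. holds `p̃`-a.e. -/
theorem IsJumpLaw.ae_pTilde_of_ae_jumpMeasure (hP : IsJumpLaw lam lam0 t x a P) (r T : ℝ≥0)
    {S : Set ((ℝ≥0 × Path (E × A)) × E × A)}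
    (hS : MeasurableSet[(pred (E × A)).prod inferInstance] S)
    (h : ∀ᵐ ω ∂P, ∀ᵐ w ∂(jumpMeasure ω).restrict (Ioc r T ×ˢ univ), ((w.1, ω), w.2) ∉ S) :
    ∀ᵐ ω ∂P, ∀ᵐ w ∂(pTilde lam lam0 t ω).restrict (Ioc r T ×ˢ univ), ((w.1, ω), w.2) ∉ S := by
  have hH : Measurable[(pred (E × A)).prod inferInstance] (S.indicator (1 : (ℝ≥0 × Path (E × A)) × E × A → ℝ≥0∞)) :=
    Measurable.indicator (m := (pred (E × A)).prod inferInstance) measurable_const hS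
  have hsec := measurable_section hH
  have h0 := (hP.isCompensator.setLIntegral_Ioc_eq r T hH).symm
  -- The expected `p`- and `p̃`-masses of `S` agree; the first is zero, and an expectation of a
  -- nonnegative measurable variable that vanishes forces it to vanish a.s.
  rw [lintegral_eq_zero_of_ae_eq_zero (f := fun ω => ∫⁻ w in Ioc r T ×ˢ univ,
      S.indicator 1 ((w.1, ω), w.2) ∂jumpMeasure ω), lintegral_eq_zero_iff
      (hP.isCompensator.measurable_setLIntegral_Ioc r T hH)] at h0
  · filter_upwards [h0] with ω hω
    have := (lintegral_eq_zero_iff (hsec ω)).1 hω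
    filter_upwards [this] with w hw
    simpa using hw
  · filter_upwards [h] with ω hω
    refine lintegral_eq_zero_of_ae_eq_zero ?_
    filter_upwards [hω] with w hw
    simp [hw]

variable [IsFiniteKernel lam] [IsFiniteMeasure lam0]

/-- The compensator identity with integrand `1` bounds the expected number of jumps by the expected
mass of `p̃`: no explosion before `T`. -/
theorem IsJumpLaw.ae_jumpMeasure_lt_top (hP : IsJumpLaw lam lam0 t x a P) (T : ℝ≥0) :
    ∀ᵐ ω ∂P, jumpMeasure ω (Ioc 0 T ×ˢ univ) < ⊤ := by
  have := hP.isProbabilityMeasure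
  obtain ⟨C, hC, h⟩ := exists_pTilde_prod_univ_le lam lam0 t
  refine ae_lt_top (measurable_jumpMeasure_Ioc_prod T MeasurableSet.univ) (ne_of_lt ?_)
  have h1 := hP.isCompensator.setLIntegral_Ioc_eq 0 T (H := fun _ => 1) measurable_const
  simp only [lintegral_one, Measure.restrict_apply_univ] at h1
  rw [h1]
  calc ∫⁻ ω, pTilde lam lam0 t ω (Ioc 0 T ×ˢ univ) ∂P ≤ ∫⁻ _, C * leb (Iic T) ∂P :=
        lintegral_mono fun ω => (h ω _ measurableSet_Ioc).trans <| by
          gcongr; exact Ioc_subset_Iic_self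
    _ = C * leb (Iic T) := by simp
    _ < ⊤ := ENNReal.mul_lt_top hC (leb_Iic_lt_top T)

/-- A predictable property that holds `p̃`-a.e. holds `p`-a.e. -/
theorem IsJumpLaw.ae_jumpMeasure_of_ae_pTilde (hP : IsJumpLaw lam lam0 t x a P) (r T : ℝ≥0)
    {S : Set ((ℝ≥0 × Path (E × A)) × E × A)}
    (hS : MeasurableSet[(pred (E × A)).prod inferInstance] S)
    (h : ∀ᵐ ω ∂P, ∀ᵐ w ∂(pTilde lam lam0 t ω).restrict (Ioc r T ×ˢ univ), ((w.1, ω), w.2) ∉ S) :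
    ∀ᵐ ω ∂P, ∀ᵐ w ∂(jumpMeasure ω).restrict (Ioc r T ×ˢ univ), ((w.1, ω), w.2) ∉ S := by
  have hH : Measurable[(pred (E × A)).prod inferInstance] (S.indicator (1 : (ℝ≥0 × Path (E × A)) × E × A → ℝ≥0∞)) :=
    Measurable.indicator (m := (pred (E × A)).prod inferInstance) measurable_const hS
  have hsec := measurable_section hH
  have h0 := hP.isCompensator.setLIntegral_Ioc_eq r T hH
  rw [lintegral_eq_zero_of_ae_eq_zero (f := fun ω => ∫⁻ w in Ioc r T ×ˢ univ,
      S.indicator 1 ((w.1, ω), w.2) ∂pTilde lam lam0 t ω), lintegral_eq_zero_iff'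
      (aemeasurable_setLIntegral_Ioc_jumpMeasure (hP.ae_jumpMeasure_lt_top T) r hH)] at h0
  · filter_upwards [h0] with ω hω
    have := (lintegral_eq_zero_iff (hsec ω)).1 hω
    filter_upwards [this] with w hw
    simpa using hw
  · filter_upwards [h] with ω hω
    refine lintegral_eq_zero_of_ae_eq_zero ?_
    filter_upwards [hω] with w hw
    simp [hw]

/-- A predictable integrand in `𝐋²(q)` is a.s. integrable with respect to `p` and `p̃`. -/
theorem IsJumpLaw.ae_integrableOn (hP : IsJumpLaw lam lam0 t x a P) (T : ℝ≥0)
    {G : (ℝ≥0 × Path (E × A)) × E × A → ℝ}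
    (hG : Measurable[(pred (E × A)).prod inferInstance] G)
    (hfin : ∫⁻ ω, ∫⁻ w in Icc t T ×ˢ univ, ‖G ((w.1, ω), w.2)‖ₑ ^ 2 ∂pTilde lam lam0 t ω ∂P < ⊤) :
    ∀ᵐ ω ∂P,
      IntegrableOn (fun w => G ((w.1, ω), w.2)) (Ioc t T ×ˢ univ) (jumpMeasure ω) ∧
      IntegrableOn (fun w => G ((w.1, ω), w.2)) (Ioc t T ×ˢ univ) (pTilde lam lam0 t ω) := by
  have := hP.isProbabilityMeasure
  have hH : Measurable[(pred (E × A)).prod inferInstance] (fun z => ‖G z‖ₑ) :=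
    measurable_enorm.comp hG
  have hlt : ∫⁻ ω, ∫⁻ w in Ioc t T ×ˢ univ, ‖G ((w.1, ω), w.2)‖ₑ ∂pTilde lam lam0 t ω ∂P < ⊤ := by
    obtain ⟨C, hC, h⟩ := exists_pTilde_prod_univ_le lam lam0 t
    -- Passes from square integrability to integrability; the constant `1` costs only the bounded
    -- mass of `p̃` on `[t, T]`.
    have hle : ∀ y : ℝ≥0∞, y ≤ 1 + y ^ 2 := fun y => by
      rcases le_total y 1 with h | h
      · exact h.trans le_self_add
      · exact (le_self_pow₀ h two_ne_zero).trans le_add_self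
    calc ∫⁻ ω, ∫⁻ w in Ioc t T ×ˢ univ, ‖G ((w.1, ω), w.2)‖ₑ ∂pTilde lam lam0 t ω ∂P
        ≤ ∫⁻ ω, (C * leb (Iic T) + ∫⁻ w in Icc t T ×ˢ univ, ‖G ((w.1, ω), w.2)‖ₑ ^ 2
            ∂pTilde lam lam0 t ω) ∂P := by
          refine lintegral_mono fun ω => ?_
          calc ∫⁻ w in Ioc t T ×ˢ univ, ‖G ((w.1, ω), w.2)‖ₑ ∂pTilde lam lam0 t ω
              ≤ ∫⁻ w in Icc t T ×ˢ univ, (1 + ‖G ((w.1, ω), w.2)‖ₑ ^ 2) ∂pTilde lam lam0 t ω :=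
                lintegral_mono' (Measure.restrict_mono (Set.prod_mono Ioc_subset_Icc_self le_rfl)
                  le_rfl) fun w => hle _
            _ = pTilde lam lam0 t ω (Icc t T ×ˢ univ) + ∫⁻ w in Icc t T ×ˢ univ,
                  ‖G ((w.1, ω), w.2)‖ₑ ^ 2 ∂pTilde lam lam0 t ω := by
                rw [lintegral_add_left measurable_const]; simp
            _ ≤ _ := by
                gcongr
                refine (h ω _ measurableSet_Icc).trans ?_
                gcongr
                exact Icc_subset_Iic_self
      _ = C * leb (Iic T) + ∫⁻ ω, ∫⁻ w in Icc t T ×ˢ univ, ‖G ((w.1, ω), w.2)‖ₑ ^ 2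
            ∂pTilde lam lam0 t ω ∂P := by
          rw [lintegral_add_left measurable_const]; simp
      _ < ⊤ := ENNReal.add_lt_top.2 ⟨ENNReal.mul_lt_top hC (leb_Iic_lt_top T), hfin⟩
  -- The expectations of `∫ |G| dp̃` and `∫ |G| dp` are equal, so both integrals are a.s. finite.
  have h1 := ae_lt_top (hP.isCompensator.measurable_setLIntegral_Ioc t T hH) hlt.ne
  have h2 := ae_lt_top' (aemeasurable_setLIntegral_Ioc_jumpMeasure
    (hP.ae_jumpMeasure_lt_top T) t hH) ((hP.isCompensator.setLIntegral_Ioc_eq t T hH).trans_lt hlt).ne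
  filter_upwards [h1, h2] with ω hω1 hω2
  have hsec := (measurable_section hG ω).aestronglyMeasurable (μ := jumpMeasure ω)
  have hsec' := (measurable_section hG ω).aestronglyMeasurable (μ := pTilde lam lam0 t ω)
  exact ⟨⟨hsec.restrict, hω2⟩, ⟨hsec'.restrict, hω1⟩⟩

end Law

/-! ### Left limits along `s - 1 / (n + 1)`. -/

section LeftLimits

theorem tendsto_inv_nat_add_one : Tendsto (fun n : ℕ => ((n : ℝ≥0) + 1)⁻¹) atTop (𝓝 0) := by
  simpa [one_div] using tendsto_one_div_add_atTop_nhds_zero_nat (𝕜 := ℝ≥0)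

theorem eventually_sub_inv_mem_Icc {t T s : ℝ≥0} (hs : s ∈ Ioc t T) :
    ∀ᶠ n : ℕ in atTop, s - ((n : ℝ≥0) + 1)⁻¹ ∈ Icc t T := by
  filter_upwards [tendsto_inv_nat_add_one.eventually_lt_const (tsub_pos_of_lt hs.1)] with n hn
  exact ⟨le_tsub_of_add_le_right
    (add_comm t _ ▸ (lt_tsub_iff_right.1 hn).le), tsub_le_self.trans hs.2⟩

theorem iInter_Ioc_sub_inv {t T s : ℝ≥0} (hs : s ∈ Ioc t T) :
    ⋂ n : ℕ, Ioc (s - ((n : ℝ≥0) + 1)⁻¹) T = {s} ∪ Ioc s T := by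
  have hpos : 0 < s := (zero_le (a := t)).trans_lt hs.1
  ext r
  simp only [mem_iInter, mem_Ioc, mem_union, mem_singleton_iff]
  constructor
  · intro h
    have h1 : Tendsto (fun n : ℕ => s - ((n : ℝ≥0) + 1)⁻¹) atTop (𝓝 s) := by
      simpa using tendsto_const_nhds.sub tendsto_inv_nat_add_one
    rcases (le_of_tendsto' h1 fun n => (h n).1.le).eq_or_lt with h2 | h2
    · exact Or.inl h2.symm
    · exact Or.inr ⟨h2, (h 0).2⟩
  · rintro (rfl | h) n
    · exact ⟨tsub_lt_self hpos (by positivity), hs.2⟩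
    · exact ⟨tsub_le_self.trans_lt h.1, h.2⟩

/-- The intervals `(s - 1 / (n + 1), T]` decrease to `[s, T]`, so the limit picks up the mass at
time `s`. Early ones may start before `t`; integrability over one member suffices. The map `τ` lets
the same statement serve measures on time and on time × marks. -/
theorem tendsto_setIntegral_Ioc_sub_inv {X : Type*} [MeasurableSpace X] {μ : Measure X}
    {τ : X → ℝ≥0} (hτ : Measurable τ) {φ : X → ℝ} {t T s : ℝ≥0} (hs : s ∈ Ioc t T)
    (hφ : IntegrableOn φ (τ ⁻¹' Ioc t T) μ) :
    Tendsto (fun n : ℕ => ∫ w in τ ⁻¹' Ioc (s - ((n : ℝ≥0) + 1)⁻¹) T, φ w ∂μ) atTop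
      (𝓝 ((∫ w in τ ⁻¹' Ioc s T, φ w ∂μ) + ∫ w in τ ⁻¹' {s}, φ w ∂μ)) := by
  obtain ⟨i, hi⟩ := (eventually_sub_inv_mem_Icc hs).exists
  have h := tendsto_setIntegral_of_antitone (μ := μ) (f := φ)
    (s := fun n : ℕ => τ ⁻¹' Ioc (s - ((n : ℝ≥0) + 1)⁻¹) T) (fun n => hτ measurableSet_Ioc)
    (fun m n hmn => preimage_mono (Ioc_subset_Ioc_left (by gcongr)))
    ⟨i, hφ.mono_set (preimage_mono (Ioc_subset_Ioc_left hi.1))⟩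
  rw [← preimage_iInter, iInter_Ioc_sub_inv hs, preimage_union, setIntegral_union
    (Disjoint.preimage τ (by simp)) (hτ measurableSet_Ioc)
    (hφ.mono_set (preimage_mono (singleton_subset_iff.2 hs)))
    (hφ.mono_set (preimage_mono (Ioc_subset_Ioc_left hs.1.le))), add_comm] at h
  exact h

end LeftLimits

/-! ### The noise term and its jumps. -/

section Noise

/-- There are countably many jump times. This reconciles `X_r` in the backward equation with
`X_{r-}` in `p̃`. -/
theorem ae_leb_state_eq_leftState {M : Type*} (ω : Path M) :
    ∀ᵐ r ∂leb, state r ω = leftState r ω := by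
  filter_upwards [(countable_jumpTimes ω).ae_notMem leb] with r hr using state_eq_leftState hr

variable {E : Type u} {A : Type v} [MeasurableSpace E] [MeasurableSpace A]

/-- The integral `∫_A φ_r(X_r, b) λ₀(db)`. -/
noncomputable def actionIntegral (lam0 : Measure A) (ω : Path (E × A)) (φ : ℝ≥0 × E × A → ℝ)
    (r : ℝ≥0) : ℝ :=
  ∫ b, (state r ω).elim 0 (fun z => φ (r, z.1, b)) ∂lam0

/-- The sum `∫_{(s, T]} φ dq + ∫_s^T ∫_A φ_r(X_r, b) λ₀(db) dr` along a path. -/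
noncomputable def noise (lam : Kernel (E × A) E) (lam0 : Measure A) (t T : ℝ≥0)
    (ω : Path (E × A)) (φ : ℝ≥0 × E × A → ℝ) (s : ℝ≥0) : ℝ :=
  (∫ w in Prod.fst ⁻¹' Ioc s T, φ w ∂jumpMeasure ω) -
    (∫ w in Prod.fst ⁻¹' Ioc s T, φ w ∂pTilde lam lam0 t ω) +
    ∫ r in Ioc s T, actionIntegral lam0 ω φ r ∂leb

variable {lam : Kernel (E × A) E} {lam0 : Measure A} {t T : ℝ≥0} {ω : Path (E × A)}
  {φ φ' : ℝ≥0 × E × A → ℝ}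

theorem integral_leftRateAction [SFinite lam0] (hφ : Measurable φ) {r : ℝ≥0}
    (hr : state r ω = leftState r ω) :
    ∫ y, φ (r, y) ∂leftRateAction lam0 ω r = actionIntegral lam0 ω φ r := by
  change ∫ y, φ (r, y) ∂((leftState r ω).elim 0 (actionRate lam0)) = _
  rw [actionIntegral, hr]
  rcases leftState r ω with _ | z
  · simp
  · change ∫ y, φ (r, y) ∂(Measure.dirac z.1).prod lam0 = _
    rw [Measure.dirac_prod]
    exact integral_map (f := fun y => φ (r, y)) measurable_prodMk_left.aemeasurable
      (hφ.comp measurable_prodMk_left).aestronglyMeasurable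

/-- Only times in `(s, T] ⊆ [t, T]` enter, so `Z` may be replaced by an extension `G`, which can be
chosen measurable on the whole time axis. -/
theorem IsSolution.eq_noise {f : ℝ≥0 → E → A → ℝ} {g : E → ℝ} {P : Measure (Path (E × A))}
    {Y : ℝ≥0 → Path (E × A) → ℝ} {Z : ℝ≥0 → Path (E × A) → E × A → ℝ}
    {K : ℝ≥0 → Path (E × A) → ℝ} (h : IsSolution lam lam0 f g P t T Y Z K)
    {G : (ℝ≥0 × Path (E × A)) × E × A → ℝ} (hG : ∀ s ∈ Icc t T, ∀ ω y, Z s ω y = G ((s, ω), y)) :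
    ∀ᵐ ω ∂P, ∀ s ∈ Icc t T, Y s ω = (state T ω).elim 0 (fun z => g z.1)
      + (∫ r in Ioc s T, (state r ω).elim 0 (fun z => f r z.1 z.2) ∂leb)
      + K T ω - K s ω - noise lam lam0 t T ω (fun w => G ((w.1, ω), w.2)) s := by
  filter_upwards [h.equation] with ω hω s hs
  have hm : MeasurableSet (Prod.fst ⁻¹' Ioc s T : Set (ℝ≥0 × E × A)) :=
    measurable_fst measurableSet_Ioc
  have hI : ∀ r ∈ Ioc s T, r ∈ Icc t T := fun r hr => ⟨hs.1.trans hr.1.le, hr.2⟩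
  have h1 : ∀ μ : Measure (ℝ≥0 × E × A), ∫ w in Ioc s T ×ˢ univ, Z w.1 ω w.2 ∂μ =
      ∫ w in Prod.fst ⁻¹' Ioc s T, G ((w.1, ω), w.2) ∂μ := fun μ => by
    rw [prod_univ]
    exact setIntegral_congr_fun hm fun w hw => hG w.1 (hI _ hw) ω w.2
  have h2 : ∫ r in Ioc s T, (∫ b, (state r ω).elim 0 (fun z => Z r ω (z.1, b)) ∂lam0) ∂leb =
      ∫ r in Ioc s T, actionIntegral lam0 ω (fun w => G ((w.1, ω), w.2)) r ∂leb := by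
    refine setIntegral_congr_fun measurableSet_Ioc fun r hr => ?_
    simp only [actionIntegral, hG r (hI r hr)]
  rw [hω s hs, integralQ, h1, h1, h2, noise]
  ring

variable [IsFiniteKernel lam] [IsFiniteMeasure lam0]

theorem integrableOn_actionIntegral (hφ : Measurable φ)
    (h : IntegrableOn φ (Prod.fst ⁻¹' Ioc t T) (pTilde lam lam0 t ω)) :
    IntegrableOn (actionIntegral lam0 ω φ) (Ioc t T) leb := by
  have hm : MeasurableSet (Prod.fst ⁻¹' Ioc t T : Set (ℝ≥0 × E × A)) :=
    measurable_fst measurableSet_Ioc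
  have h1 : Integrable ((Prod.fst ⁻¹' Ioc t T).indicator φ)
      ((leb.restrict (Ici t)).compProd (leftRateAction lam0 ω)) :=
    ((integrable_indicator_iff hm).2 h).mono_measure (compProd_leftRateAction_le lam lam0 t ω)
  have h2 : Integrable (fun r => ∫ y, (Prod.fst ⁻¹' Ioc t T).indicator φ (r, y)
      ∂leftRateAction lam0 ω r) (leb.restrict (Ici t)) := by
    simpa using Integrable.integral_compProd (κ := Kernel.const Unit (leb.restrict (Ici t)))
      (η := Kernel.prodMkLeft Unit (leftRateAction lam0 ω)) (a := ()) h1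
  have h3 : IntegrableOn (fun r => ∫ y, (Prod.fst ⁻¹' Ioc t T).indicator φ (r, y)
      ∂leftRateAction lam0 ω r) (Ioc t T) leb :=
    IntegrableOn.mono_set h2 fun r hr => hr.1.le
  refine Integrable.congr h3 ?_
  filter_upwards [ae_restrict_of_ae (ae_leb_state_eq_leftState ω),
    ae_restrict_mem measurableSet_Ioc] with r hr hr'
  rw [← integral_leftRateAction hφ hr]
  refine integral_congr_ae (ae_of_all _ fun y => ?_)
  exact indicator_of_mem (s := Prod.fst ⁻¹' Ioc t T) (a := (r, y)) hr' φ

theorem actionIntegral_ae_eq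
    (h : ∀ᵐ w ∂(pTilde lam lam0 t ω).restrict (Prod.fst ⁻¹' Ioc t T), φ w = φ' w) :
    ∀ᵐ r ∂leb.restrict (Ioc t T), actionIntegral lam0 ω φ r = actionIntegral lam0 ω φ' r := by
  have h1 : ∀ᵐ w ∂(leb.restrict (Ici t)).compProd (leftRateAction lam0 ω),
      w.1 ∈ Ioc t T → φ w = φ' w :=
    Measure.absolutelyContinuous_of_le (compProd_leftRateAction_le lam lam0 t ω)
      |>.ae_le ((ae_restrict_iff' (measurable_fst measurableSet_Ioc)).1 h)
  have h2 := ae_restrict_of_ae_restrict_of_subset (s := Ioc t T) (t := Ici t)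
    (fun r hr => hr.1.le) (Measure.ae_ae_of_ae_compProd h1)
  filter_upwards [h2, ae_restrict_of_ae (ae_leb_state_eq_leftState ω),
    ae_restrict_mem measurableSet_Ioc] with r hr hst hmem
  change ∀ᵐ y ∂((leftState r ω).elim 0 (actionRate lam0)), _ at hr
  rw [actionIntegral, actionIntegral, hst]
  rcases hls : leftState r ω with _ | z
  · simp
  · rw [hls] at hr
    change ∀ᵐ y ∂(Measure.dirac z.1).prod lam0, _ at hr
    rw [Measure.dirac_prod] at hr
    refine integral_congr_ae ?_
    filter_upwards [ae_of_ae_map (by fun_prop) hr] with b hb using hb hmem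

/-- Neither `p̃` nor Lebesgue measure charges a single time, so the left limit exceeds the value
exactly by the atom of `p` at `s`. -/
theorem tendsto_noise (hφ : Measurable φ)
    (hp : IntegrableOn φ (Prod.fst ⁻¹' Ioc t T) (jumpMeasure ω))
    (hp' : IntegrableOn φ (Prod.fst ⁻¹' Ioc t T) (pTilde lam lam0 t ω)) {s : ℝ≥0}
    (hs : s ∈ Ioc t T) :
    Tendsto (fun n : ℕ => noise lam lam0 t T ω φ (s - ((n : ℝ≥0) + 1)⁻¹)) atTop
      (𝓝 (noise lam lam0 t T ω φ s + ∫ w in {s} ×ˢ univ, φ w ∂jumpMeasure ω)) := by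
  have h1 := tendsto_setIntegral_Ioc_sub_inv measurable_fst hs hp
  have h2 := tendsto_setIntegral_Ioc_sub_inv measurable_fst hs hp'
  have h3 := tendsto_setIntegral_Ioc_sub_inv measurable_id hs (integrableOn_actionIntegral hφ hp')
  have h2' : ∫ w in Prod.fst ⁻¹' {s}, φ w ∂pTilde lam lam0 t ω = 0 :=
    setIntegral_measure_zero _ (by
      rw [← prod_univ]
      exact pTilde_prod_univ_eq_zero lam lam0 t ω (measurableSet_singleton s) (measure_singleton s))
  have h3' : ∫ r in id ⁻¹' {s}, actionIntegral lam0 ω φ r ∂leb = 0 :=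
    setIntegral_measure_zero _ (measure_singleton s)
  rw [h2', add_zero] at h2
  rw [h3', add_zero] at h3
  convert! (h1.sub h2).add h3 using 2
  rw [noise, prod_univ, preimage_id]
  ring

theorem noise_congr
    (hp : ∀ᵐ w ∂(jumpMeasure ω).restrict (Prod.fst ⁻¹' Ioc t T), φ w = φ' w)
    (hp' : ∀ᵐ w ∂(pTilde lam lam0 t ω).restrict (Prod.fst ⁻¹' Ioc t T), φ w = φ' w) {s : ℝ≥0}
    (hs : t ≤ s) : noise lam lam0 t T ω φ s = noise lam lam0 t T ω φ' s := by
  have hsub : (Prod.fst ⁻¹' Ioc s T : Set (ℝ≥0 × E × A)) ⊆ Prod.fst ⁻¹' Ioc t T :=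
    preimage_mono (Ioc_subset_Ioc_left hs)
  have h1 := integral_congr_ae (ae_restrict_of_ae_restrict_of_subset hsub hp)
  have h2 := integral_congr_ae (ae_restrict_of_ae_restrict_of_subset hsub hp')
  have h3 := integral_congr_ae (ae_restrict_of_ae_restrict_of_subset (Ioc_subset_Ioc_left hs)
    (actionIntegral_ae_eq hp'))
  rw [noise, noise, h1, h2, h3]

end Noise

/-! ### `Y` determines `Z` and `K`. -/

section Uniqueness

/-- The points of `(t, T]` at which a process is not left-continuous along `s - 1 / (n + 1)`. -/
def leftJumpSet {M : Type u} (t T : ℝ≥0) (U : ℝ≥0 × Path M → ℝ) : Set (ℝ≥0 × Path M) :=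
  {z | z.1 ∈ Ioc t T ∧
    ¬ Tendsto (fun n : ℕ => U (z.1 - ((n : ℝ≥0) + 1)⁻¹, z.2) - U z) atTop (𝓝 0)}

/-- Delayed copies of a predictable process are predictable, and convergence of a sequence of
measurable functions is a measurable event; this is why left limits are tested along one sequence.
-/
theorem measurableSet_leftJumpSet {M : Type u} [MeasurableSpace M] (t T : ℝ≥0)
    {U : ℝ≥0 × Path M → ℝ} (hU : Measurable[pred M] U) :
    MeasurableSet[pred M] (leftJumpSet t T U) := by
  let : MeasurableSpace (ℝ≥0 × Path M) := pred M
  have h1 : MeasurableSet {z : ℝ≥0 × Path M | z.1 ∈ Ioc t T} :=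
    measurable_pred_fst measurableSet_Ioc
  exact h1.inter (measurableSet_tendsto (𝓝 0) fun n : ℕ =>
    (hU.comp (measurable_pred_shift ((n : ℝ≥0) + 1)⁻¹)).sub hU).compl

variable {E : Type u} {A : Type v} [MeasurableSpace E] [MeasurableSpace A]
  {lam : Kernel (E × A) E} [IsFiniteKernel lam] {lam0 : Measure A} [IsFiniteMeasure lam0]
  {t T : ℝ≥0} {x : E} {a : A} {P : Measure (Path (E × A))}

/-- A process whose increments are those of the difference of two noise terms is continuous off the
jump times, and the integrands agree at the jump times at which it is left-continuous. -/
theorem notMem_leftJumpSet_iff {ω : Path (E × A)} {φ φ' : ℝ≥0 × E × A → ℝ}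
    (hφ : Measurable φ) (hφ' : Measurable φ')
    (hi : IntegrableOn φ (Prod.fst ⁻¹' Ioc t T) (jumpMeasure ω) ∧
      IntegrableOn φ (Prod.fst ⁻¹' Ioc t T) (pTilde lam lam0 t ω))
    (hi' : IntegrableOn φ' (Prod.fst ⁻¹' Ioc t T) (jumpMeasure ω) ∧
      IntegrableOn φ' (Prod.fst ⁻¹' Ioc t T) (pTilde lam lam0 t ω))
    {U : ℝ≥0 × Path (E × A) → ℝ} {c : ℝ}
    (hU : ∀ s ∈ Icc t T, U (s, ω) =
      c - (noise lam lam0 t T ω φ s - noise lam lam0 t T ω φ' s))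
    {s : ℝ≥0} (hs : s ∈ Ioc t T) :
    (s, ω) ∉ leftJumpSet t T U ↔
      ∫ w in {s} ×ˢ univ, φ w ∂jumpMeasure ω = ∫ w in {s} ×ˢ univ, φ' w ∂jumpMeasure ω := by
  have h1 : Tendsto (fun n : ℕ => U (s - ((n : ℝ≥0) + 1)⁻¹, ω) - U (s, ω)) atTop
      (𝓝 ((∫ w in {s} ×ˢ univ, φ' w ∂jumpMeasure ω) - ∫ w in {s} ×ˢ univ, φ w ∂jumpMeasure ω)) := by
    have h2 := ((tendsto_noise hφ' hi'.1 hi'.2 hs).sub (tendsto_noise hφ hi.1 hi.2 hs)).add_const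
      (noise lam lam0 t T ω φ s - noise lam lam0 t T ω φ' s)
    have h3 : noise lam lam0 t T ω φ' s + (∫ w in {s} ×ˢ univ, φ' w ∂jumpMeasure ω) -
        (noise lam lam0 t T ω φ s + ∫ w in {s} ×ˢ univ, φ w ∂jumpMeasure ω) +
        (noise lam lam0 t T ω φ s - noise lam lam0 t T ω φ' s) =
        (∫ w in {s} ×ˢ univ, φ' w ∂jumpMeasure ω) - ∫ w in {s} ×ˢ univ, φ w ∂jumpMeasure ω := by
      ring
    rw [h3] at h2
    refine h2.congr' ?_
    filter_upwards [eventually_sub_inv_mem_Icc hs] with n hn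
    rw [hU _ hn, hU s ⟨hs.1.le, hs.2⟩]
    ring
  have h4 : (s, ω) ∉ leftJumpSet t T U ↔
      Tendsto (fun n : ℕ => U (s - ((n : ℝ≥0) + 1)⁻¹, ω) - U (s, ω)) atTop (𝓝 0) := by
    simp only [leftJumpSet, mem_ofPred_eq, hs, true_and, not_not]
  rw [h4]
  constructor
  · intro h
    exact (sub_eq_zero.1 (tendsto_nhds_unique h1 h)).symm
  · intro h
    rwa [h, sub_self] at h1

/-- The components `Z` and `K` of a solution are determined by `Y`. -/
theorem IsSolution.unique_of_eq (hP : IsJumpLaw lam lam0 t x a P) (htT : t ≤ T)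
    {f : ℝ≥0 → E → A → ℝ} {g : E → ℝ}
    {Y Y' : ℝ≥0 → Path (E × A) → ℝ} {Z Z' : ℝ≥0 → Path (E × A) → E × A → ℝ}
    {K K' : ℝ≥0 → Path (E × A) → ℝ} (h : IsSolution lam lam0 f g P t T Y Z K)
    (h' : IsSolution lam lam0 f g P t T Y' Z' K')
    (hY : ∀ᵐ ω ∂P, ∀ s ∈ Icc t T, Y s ω = Y' s ω) :
    (∀ᵐ ω ∂P, ∀ᵐ w ∂((pTilde lam lam0 t ω).restrict (Icc t T ×ˢ univ)),
      Z w.1 ω w.2 = Z' w.1 ω w.2) ∧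
    (∀ᵐ ω ∂P, ∀ s ∈ Icc t T, K s ω = K' s ω) := by
  obtain ⟨G, hG, hZG⟩ := exists_pred_extension h.memL2q.measurable
  obtain ⟨G', hG', hZG'⟩ := exists_pred_extension h'.memL2q.measurable
  obtain ⟨V, hV, hKV⟩ := exists_pred_extension' h.memK2.predictable
  obtain ⟨V', hV', hKV'⟩ := exists_pred_extension' h'.memK2.predictable
  have hIcc : MeasurableSet (Icc t T ×ˢ univ : Set (ℝ≥0 × E × A)) :=
    measurableSet_Icc.prod MeasurableSet.univ
  have hint : ∀ {Z : ℝ≥0 → Path (E × A) → E × A → ℝ} {G : (ℝ≥0 × Path (E × A)) × E × A → ℝ},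
      MemL2q lam lam0 P t T Z → Measurable[(pred (E × A)).prod inferInstance] G →
      (∀ s ∈ Icc t T, ∀ ω y, Z s ω y = G ((s, ω), y)) → ∀ᵐ ω ∂P,
        IntegrableOn (fun w => G ((w.1, ω), w.2)) (Prod.fst ⁻¹' Ioc t T) (jumpMeasure ω) ∧
        IntegrableOn (fun w => G ((w.1, ω), w.2)) (Prod.fst ⁻¹' Ioc t T)
          (pTilde lam lam0 t ω) := by
    intro Z G hZ hG hZG
    rw [← prod_univ]
    refine hP.ae_integrableOn T hG (lt_of_le_of_lt (le_of_eq ?_) hZ.lintegral_lt_top)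
    refine lintegral_congr fun ω => setLIntegral_congr_fun hIcc fun w hw => ?_
    simp only [hZG w.1 hw.1 ω w.2]
  -- The terms in `Y`, `g` and `f` are common to both equations and cancel.
  have hdiff : ∀ᵐ ω ∂P, ∀ s ∈ Icc t T, K s ω - K' s ω = K T ω - K' T ω -
      (noise lam lam0 t T ω (fun w => G ((w.1, ω), w.2)) s -
        noise lam lam0 t T ω (fun w => G' ((w.1, ω), w.2)) s) := by
    filter_upwards [h.eq_noise hZG, h'.eq_noise hZG', hY] with ω h1 h2 h3 s hs
    linarith [h1 s hs, h2 s hs, h3 s hs]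
  have hU : Measurable[pred (E × A)] fun z => V z - V' z := hV.sub hV'
  have hiff : ∀ᵐ ω ∂P, ∀ s ∈ Ioc t T, (s, ω) ∉ leftJumpSet t T (fun z => V z - V' z) ↔
      ∫ w in {s} ×ˢ univ, G ((w.1, ω), w.2) ∂jumpMeasure ω =
        ∫ w in {s} ×ˢ univ, G' ((w.1, ω), w.2) ∂jumpMeasure ω := by
    filter_upwards [hint h.memL2q hG hZG, hint h'.memL2q hG' hZG', hdiff] with ω h1 h2 h3 s hs
    refine notMem_leftJumpSet_iff (measurable_section hG ω) (measurable_section hG' ω) h1 h2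
      (c := K T ω - K' T ω) (fun r hr => ?_) hs
    rw [← h3 r hr, hKV r hr, hKV' r hr]
  have hB : MeasurableSet[(pred (E × A)).prod inferInstance]
      (Prod.fst ⁻¹' leftJumpSet t T (fun z => V z - V' z) :
        Set ((ℝ≥0 × Path (E × A)) × E × A)) := by
    let : MeasurableSpace (ℝ≥0 × Path (E × A)) := pred (E × A)
    exact measurable_fst (measurableSet_leftJumpSet t T hU)
  have hS : MeasurableSet[(pred (E × A)).prod inferInstance]
      {z : (ℝ≥0 × Path (E × A)) × E × A | G z ≠ G' z} := by
    let : MeasurableSpace (ℝ≥0 × Path (E × A)) := pred (E × A)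
    exact (measurableSet_eq_fun hG hG').compl
  -- The crux: discontinuities of `K - K'` lie in the countable set of jump times, so they are
  -- `p̃`-null; being predictable, they are `p`-null too, which rules them out at the jump times
  -- themselves.
  have hcont : ∀ᵐ ω ∂P, ∀ᵐ w ∂(jumpMeasure ω).restrict (Ioc t T ×ˢ univ),
      ((w.1, ω), w.2) ∉ (Prod.fst ⁻¹' leftJumpSet t T (fun z => V z - V' z) :
        Set ((ℝ≥0 × Path (E × A)) × E × A)) := by
    refine hP.ae_jumpMeasure_of_ae_pTilde t T hB ?_
    filter_upwards [hiff] with ω hω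
    have hnull : ∀ᵐ w ∂pTilde lam lam0 t ω, w ∉ jumpTimes ω ×ˢ (univ : Set (E × A)) :=
      measure_eq_zero_iff_ae_notMem.1 (pTilde_prod_univ_eq_zero lam lam0 t ω
        (countable_jumpTimes ω).measurableSet ((countable_jumpTimes ω).measure_zero leb))
    filter_upwards [ae_restrict_of_ae hnull,
      ae_restrict_mem (measurableSet_Ioc.prod MeasurableSet.univ)] with w hw hmem
    have h0 := jumpMeasure_singleton_prod_of_notMem (ω := ω) (s := w.1) fun hj => hw ⟨hj, trivial⟩
    refine (hω w.1 hmem.1).2 ?_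
    rw [setIntegral_measure_zero _ h0, setIntegral_measure_zero _ h0]
  -- At a jump time the restriction of `p` is a Dirac mass, so equality of the atom integrals is
  -- equality of the integrands at the mark.
  have hp : ∀ᵐ ω ∂P, ∀ᵐ w ∂(jumpMeasure ω).restrict (Ioc t T ×ˢ univ),
      ((w.1, ω), w.2) ∉ {z : (ℝ≥0 × Path (E × A)) × E × A | G z ≠ G' z} := by
    filter_upwards [hcont, hiff] with ω h1 h2
    rw [ae_restrict_jumpMeasure_iff hB] at h1
    refine (ae_restrict_jumpMeasure_iff hS).2 ?_
    rintro n ⟨s, y⟩ hn hs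
    have h3 := (h2 s hs).1 (h1 n _ hn hs)
    rw [jumpMeasure_restrict_singleton_prod hn,
      integral_dirac' _ _ (measurable_section hG ω).stronglyMeasurable,
      integral_dirac' _ _ (measurable_section hG' ω).stronglyMeasurable] at h3
    simpa using h3
  have hp' := hP.ae_pTilde_of_ae_jumpMeasure t T hS hp
  simp only [mem_ofPred_eq, not_not] at hp hp'
  refine ⟨?_, ?_⟩
  · filter_upwards [hp'] with ω hω
    -- The argument covers `(t, T]`; the endpoint `t` is `p̃`-null.
    have hnull : ∀ᵐ w ∂pTilde lam lam0 t ω, w ∉ ({t} : Set ℝ≥0) ×ˢ (univ : Set (E × A)) :=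
      measure_eq_zero_iff_ae_notMem.1 (pTilde_prod_univ_eq_zero lam lam0 t ω
        (measurableSet_singleton t) (measure_singleton t))
    rw [ae_restrict_iff' (measurableSet_Ioc.prod MeasurableSet.univ)] at hω
    rw [ae_restrict_iff' hIcc]
    filter_upwards [hω, hnull] with w h1 h2 h3
    rw [hZG w.1 h3.1 ω w.2, hZG' w.1 h3.1 ω w.2]
    exact h1 ⟨⟨lt_of_le_of_ne h3.1.1 fun heq => h2 ⟨heq.symm, trivial⟩, h3.1.2⟩, trivial⟩
  · filter_upwards [hp, hp', hdiff, h.memK2.initial, h'.memK2.initial] with ω h1 h2 h3 h4 h5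
    rw [prod_univ] at h1 h2
    -- With equal noise terms `K - K'` is constant in time; its value at `t` is `0`.
    have h6 : ∀ s ∈ Icc t T, K s ω - K' s ω = K T ω - K' T ω := fun s hs => by
      rw [h3 s hs, noise_congr h1 h2 hs.1, sub_self, sub_zero]
    intro s hs
    have h7 := h6 t ⟨le_rfl, htT⟩
    rw [h4, h5, sub_self] at h7
    linarith [h6 s hs]

end Uniqueness

end JumpBSDE

/-! ### The uniqueness theorem. -/

open JumpBSDE in
theorem mainTheorem8 {E : Type*} {A : Type*}
    [TopologicalSpace E] [MeasurableSpace E] [BorelSpace E] (hE : IsLusinSpace E)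
    [TopologicalSpace A] [MeasurableSpace A] [BorelSpace A] (hA : IsLusinSpace A)
    (lam : Kernel (E × A) E) [IsFiniteKernel lam]
    (lam0 : Measure A) [IsFiniteMeasure lam0] [lam0.IsOpenPosMeasure]
    (T : ℝ≥0) (hT : 0 < T)
    (f : ℝ≥0 → E → A → ℝ)
    (hf : Measurable fun z : Icc 0 T × E × A => f z.1 z.2.1 z.2.2)
    (hf_bdd : ∃ C : ℝ, ∀ r ∈ Icc 0 T, ∀ x a, |f r x a| ≤ C)
    (g : E → ℝ) (hg : Measurable g) (hg_bdd : ∃ C : ℝ, ∀ x, |g x| ≤ C)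
    (t : ℝ≥0) (ht : t ∈ Icc 0 T) (x : E) (a : A)
    (P : Measure (Path (E × A))) (hP : IsJumpLaw lam lam0 t x a P)
    (Y Y' : ℝ≥0 → Path (E × A) → ℝ) (Z Z' : ℝ≥0 → Path (E × A) → E × A → ℝ)
    (K K' : ℝ≥0 → Path (E × A) → ℝ)
    (h : IsMinimalSolution lam lam0 f g P t T Y Z K)
    (h' : IsMinimalSolution lam lam0 f g P t T Y' Z' K') :
    (∀ᵐ ω ∂P, ∀ s ∈ Icc t T, Y s ω = Y' s ω) ∧
    (∀ᵐ ω ∂P, ∀ᵐ w ∂((pTilde lam lam0 t ω).restrict (Icc t T ×ˢ univ)),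
      Z w.1 ω w.2 = Z' w.1 ω w.2) ∧
    (∀ᵐ ω ∂P, ∀ s ∈ Icc t T, K s ω = K' s ω) := by
  have hY : ∀ᵐ ω ∂P, ∀ s ∈ Icc t T, Y s ω = Y' s ω := by
    filter_upwards [h.le Y' Z' K' h'.isSolution, h'.le Y Z K h.isSolution] with ω h1 h2 s hs
    exact le_antisymm (h1 s hs) (h2 s hs)
  exact ⟨hY, h.isSolution.unique_of_eq hP ht.2 h'.isSolution hY⟩
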